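/- Let $k\in\{3,4\}$ and $q=p^m$ with $p$ a prime and $m\ge 1$ an integer. Assume $p\equiv 1\pmod k$ and, if $k=4$, that $m$ is even. Let $\Gamma(k,q)$ be the generalized Paley graph, i.e. the Cayley digraph with vertex set $\mathbb{F}_q$ in which there is an arrow from $u$ to $v$ if and only if $v-u=x^k$ for some $x\in\mathbb{F}_q^*$. Then $\Gamma(k,q)$ is a Ramanujan graph. That is, it is an undirected simple graph, it is connected and $n$-regular for some $n$, and every eigenvalue $\lambda$ of its adjacency matrix satisfies $|\lambda|=n$ or $|\lambda|\le 2\sqrt{n-1}$. -/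

import Mathlib

/-- The generalized Paley graph `Γ(k, q)` over a finite field `F` with `q` elements: the Cayley
digraph `X(F, R_k)` with vertex set `F` and connection set `R_k = {x ^ k : x ∈ F, x ≠ 0}`, so that
there is an arrow from `u` to `v` if and only if `v - u = x ^ k` for some nonzero `x`. -/
def generalizedPaley (k : ℕ) (F : Type*) [Field F] : Digraph F where
  Adj u v := ∃ x : F, x ≠ 0 ∧ v - u = x ^ k

open Classical in
/-- A finite undirected simple graph is Ramanujan if it is connected, `n`-regular for some `n`, and
every eigenvalue `μ` of its adjacency matrix satisfies `|μ| = n` or `|μ| ≤ 2 √(n - 1)`.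
(The adjacency matrix is real symmetric, so all its eigenvalues are real.) -/
def SimpleGraph.IsRamanujan {V : Type*} [Fintype V] (G : SimpleGraph V) : Prop :=
  G.Connected ∧ ∃ n : ℕ, G.IsRegularOfDegree n ∧
    ∀ μ : ℝ, Module.End.HasEigenvalue (Matrix.toLin' (G.adjMatrix ℝ)) μ →
      |μ| = (n : ℝ) ∨ |μ| ≤ 2 * √((n : ℝ) - 1)

/-- A digraph is an (undirected) Ramanujan graph if it has no loops, its arrows come in opposite
pairs, so that it is an undirected simple graph `G`, and this `G` is Ramanujan. -/
def Digraph.IsRamanujan {V : Type*} [Fintype V] (D : Digraph V) : Prop :=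
  ∃ G : SimpleGraph V, (∀ u v : V, G.Adj u v ↔ D.Adj u v) ∧ G.IsRamanujan

/-! Eigenvalues of a Cayley graph on an abelian group are character sums over the connection set,
here the set of nonzero `k`-th powers, of size `n = (q - 1) / k`. The trivial character gives `n`.
For the others, detecting `k`-th powers by the powers of a multiplicative character of order `k`
gives `k` times the sum as `-1` plus `k - 1` Gauss sums of norm `√q`, hence the bound `((k - 1)√q +
1) / k`. This is at most `2√(n - 1)` except for `k = 3`, `q = 7`, where the trivial bound `n = 2`
suffices. -/

/-! ### Cayley graphs: spectrum, regularity, connectivity -/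

open Finset in
theorem SimpleGraph.exists_addChar_of_hasEigenvalue {A : Type*} [AddCommGroup A] [Fintype A]
    (G : SimpleGraph A) [DecidableEq A] [DecidableRel G.Adj] (S : Finset A)
    (hG : ∀ u v, G.Adj u v ↔ v - u ∈ S) {μ : ℝ}
    (hμ : Module.End.HasEigenvalue (Matrix.toLin' (G.adjMatrix ℝ)) μ) :
    ∃ ψ : AddChar A ℂ, (μ : ℂ) = ∑ s ∈ S, ψ s := by
  obtain ⟨f, hf⟩ := hμ.exists_hasEigenvector
  have hAf : ∀ u, ∑ s ∈ S, f (u + s) = μ * f u := by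
    intro u
    have h := congrFun hf.apply_eq_smul u
    rw [Matrix.toLin'_apply, SimpleGraph.adjMatrix_mulVec_apply, Pi.smul_apply, smul_eq_mul] at h
    rw [← h]
    refine sum_bij' (fun s _ ↦ u + s) (fun v _ ↦ v - u) ?_ ?_ ?_ ?_ ?_ <;> simp [hG]
  -- By Fourier inversion, a nonzero eigenvector has a nonzero Fourier coefficient.
  have hne : ∃ ψ : AddChar A ℂ, ∑ u, (f u : ℂ) * ψ (-u) ≠ 0 := by
    by_contra! h
    refine hf.2 (funext fun v ↦ ?_)
    have h1 : ∑ ψ : AddChar A ℂ, (∑ u, (f u : ℂ) * ψ (-u)) * ψ v = 0 := by simp [h]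
    simp_rw [sum_mul, mul_assoc, ← AddChar.map_add_eq_mul] at h1
    rw [sum_comm] at h1
    simp_rw [← mul_sum, AddChar.sum_apply_eq_ite, neg_add_eq_zero] at h1
    simpa using h1
  obtain ⟨ψ, hψ⟩ := hne
  refine ⟨ψ, mul_right_cancel₀ hψ ?_⟩
  calc (μ : ℂ) * ∑ u, (f u : ℂ) * ψ (-u) = ∑ u, (∑ s ∈ S, (f (u + s) : ℂ)) * ψ (-u) := by
        rw [mul_sum]
        refine sum_congr rfl fun u _ ↦ ?_
        rw [← mul_assoc, ← Complex.ofReal_mul, ← hAf u, Complex.ofReal_sum]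
    _ = ∑ s ∈ S, ∑ u, (f (u + s) : ℂ) * ψ (-u) := by
        simp_rw [sum_mul]
        exact sum_comm
    _ = ∑ s ∈ S, ψ s * ∑ u, (f u : ℂ) * ψ (-u) := by
        refine sum_congr rfl fun s _ ↦ ?_
        rw [mul_sum]
        refine Fintype.sum_equiv (Equiv.addRight s) _ _ fun u ↦ ?_
        rw [Equiv.coe_addRight, mul_left_comm, ← AddChar.map_add_eq_mul]
        congr 2
        simp
    _ = (∑ s ∈ S, ψ s) * ∑ u, (f u : ℂ) * ψ (-u) := by rw [sum_mul]

theorem SimpleGraph.isRegularOfDegree_of_adj_iff_sub_mem {A : Type*} [AddCommGroup A] [Fintype A]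
    (G : SimpleGraph A) [G.LocallyFinite] (S : Finset A)
    (hG : ∀ u v, G.Adj u v ↔ v - u ∈ S) : G.IsRegularOfDegree S.card := by
  intro u
  rw [← SimpleGraph.card_neighborFinset_eq_degree]
  refine Finset.card_bij' (fun v _ ↦ v - u) (fun s _ ↦ u + s) ?_ ?_ ?_ ?_ <;> simp [hG]

theorem SimpleGraph.connected_of_closure_eq_top {A : Type*} [AddCommGroup A]
    (G : SimpleGraph A) (S : Set A) (hG : ∀ u v, G.Adj u v ↔ v - u ∈ S)
    (hS : AddSubgroup.closure S = ⊤) : G.Connected := by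
  have key : ∀ r : A, ∀ u, G.Reachable u (u + r) := by
    intro r
    have hr : r ∈ AddSubgroup.closure S := hS ▸ AddSubgroup.mem_top r
    induction hr using AddSubgroup.closure_induction with
    | mem x hx => exact fun u ↦ ((hG u (u + x)).2 (by simpa using hx)).reachable
    | zero => exact fun u ↦ by simp
    | add x y _ _ hx hy => exact fun u ↦ (hx u).trans (by simpa [add_assoc] using hy (u + x))
    | neg x _ hx => exact fun u ↦ (by simpa using (hx (u + -x)).symm)
  have : Nonempty A := ⟨0⟩
  exact SimpleGraph.Connected.mk fun u v ↦ by simpa using key (v - u) u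

/-- A subset of size exceeding `p ^ m / p` generates a group of order `p ^ m`. -/
theorem AddSubgroup.closure_eq_top_of_card_lt {A : Type*} [AddCommGroup A] [Fintype A] {p m : ℕ}
    (hp : p.Prime) (hA : Fintype.card A = p ^ m) (S : Finset A) (h0 : (0 : A) ∉ S)
    (hS : p ^ m < p * (S.card + 1)) : AddSubgroup.closure (S : Set A) = ⊤ := by
  classical
  set H := AddSubgroup.closure (S : Set A)
  have hcard : S.card + 1 ≤ Nat.card H := by
    rw [← Finset.card_insert_of_notMem h0, ← Set.ncard_coe_finset]
    refine Set.ncard_le_ncard (t := (H : Set A)) ?_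
    rw [Finset.coe_insert, Set.insert_subset_iff]
    exact ⟨H.zero_mem, AddSubgroup.subset_closure⟩
  have hdvd : Nat.card H ∣ p ^ m := by
    rw [← hA, ← Nat.card_eq_fintype_card]
    exact AddSubgroup.card_addSubgroup_dvd_card H
  obtain ⟨j, hj, hHj⟩ := (Nat.dvd_prime_pow hp).1 hdvd
  rcases hj.lt_or_eq with hlt | rfl
  · have h1 : p ^ (j + 1) ≤ p ^ m := Nat.pow_le_pow_right hp.pos hlt
    rw [pow_succ', ← hHj] at h1
    exact absurd (hS.trans_le (Nat.mul_le_mul_left p hcard)) h1.not_gt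
  · apply AddSubgroup.eq_top_of_card_eq
    rw [hHj, Nat.card_eq_fintype_card, hA]

/-! ### Gauss sums and Gaussian periods -/

theorem norm_gaussSum_eq_sqrt_card {F : Type*} [Field F] [Fintype F] {χ : MulChar F ℂ} (hχ : χ ≠ 1)
    {ψ : AddChar F ℂ} (hψ : ψ ≠ 1) : ‖gaussSum χ ψ‖ = √(Fintype.card F) := by
  have h := gaussSum_mul_gaussSum_eq_card hχ (AddChar.IsPrimitive.of_ne_one hψ)
  rw [← star_gaussSum_eq, RCLike.star_def, Complex.mul_conj'] at h
  rw [← Real.sqrt_sq (norm_nonneg (gaussSum χ ψ))]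
  congr 1
  exact_mod_cast h

open Classical in
/-- The set of `k`-th powers of nonzero elements of a finite field. -/
noncomputable def nonzeroPowers (k : ℕ) (F : Type*) [Field F] [Fintype F] : Finset F :=
  Finset.univ.filter fun y ↦ ∃ x : F, x ≠ 0 ∧ y = x ^ k

theorem mem_nonzeroPowers {k : ℕ} {F : Type*} [Field F] [Fintype F] {y : F} :
    y ∈ nonzeroPowers k F ↔ ∃ x : F, x ≠ 0 ∧ y = x ^ k := by
  simp [nonzeroPowers]

theorem zero_notMem_nonzeroPowers {k : ℕ} {F : Type*} [Field F] [Fintype F] :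
    (0 : F) ∉ nonzeroPowers k F := by
  rw [mem_nonzeroPowers]
  rintro ⟨x, hx, h⟩
  exact pow_ne_zero k hx h.symm

theorem MulChar.apply_eq_one_iff_mem_nonzeroPowers {F : Type*} [Field F] [Fintype F]
    (χ : MulChar F ℂ) {y : F} (hy : y ≠ 0) :
    χ y = 1 ↔ y ∈ nonzeroPowers (orderOf χ) F := by
  rw [mem_nonzeroPowers]
  constructor
  · intro h
    obtain ⟨g, hg⟩ := IsCyclic.exists_generator (α := Fˣ)
    obtain ⟨j, hj⟩ := (mem_powers_iff_mem_zpowers).2 (hg (Units.mk0 y hy))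
    have hj : g ^ j = Units.mk0 y hy := hj
    have hyj : y = (g : F) ^ j := by rw [← Units.val_pow_eq_pow_val, hj, Units.val_mk0]
    have hχj : χ ^ j = 1 := by
      rw [MulChar.eq_iff hg, MulChar.pow_apply_coe, ← map_pow, ← hyj, h, MulChar.one_apply_coe]
    obtain ⟨i, rfl⟩ := orderOf_dvd_of_pow_eq_one hχj
    exact ⟨(g : F) ^ i, pow_ne_zero _ g.ne_zero, by rw [hyj, ← pow_mul, mul_comm]⟩
  · rintro ⟨x, hx, rfl⟩
    rw [map_pow, ← MulChar.pow_apply' χ χ.orderOf_pos.ne', pow_orderOf_eq_one,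
      MulChar.one_apply hx.isUnit]

-- A geometric sum in `χ y`. At `y = 0` even the term `i = 0` vanishes, since the trivial
-- multiplicative character is zero there.
open Finset in
theorem MulChar.sum_pow_apply {F : Type*} [Field F] [Fintype F] [DecidableEq F]
    (χ : MulChar F ℂ) (y : F) :
    ∑ i ∈ range (orderOf χ), (χ ^ i) y =
      if y ∈ nonzeroPowers (orderOf χ) F then (orderOf χ : ℂ) else 0 := by
  rcases eq_or_ne y 0 with rfl | hy
  · simp [zero_notMem_nonzeroPowers]
  lift y to Fˣ using hy.isUnit
  simp_rw [MulChar.pow_apply_coe]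
  split_ifs with h
  · rw [(χ.apply_eq_one_iff_mem_nonzeroPowers hy).2 h]
    simp
  · have h1 : χ y ≠ 1 := fun h' ↦ h ((χ.apply_eq_one_iff_mem_nonzeroPowers hy).1 h')
    rw [geom_sum_eq h1, ← MulChar.pow_apply_coe, pow_orderOf_eq_one, MulChar.one_apply_coe]
    simp

open Finset in
theorem MulChar.orderOf_mul_sum_nonzeroPowers {F : Type*} [Field F] [Fintype F]
    (χ : MulChar F ℂ) (ψ : AddChar F ℂ) :
    (orderOf χ : ℂ) * ∑ y ∈ nonzeroPowers (orderOf χ) F, ψ y =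
      ∑ i ∈ range (orderOf χ), gaussSum (χ ^ i) ψ := by
  classical
  simp_rw [gaussSum]
  rw [sum_comm]
  simp_rw [← sum_mul, MulChar.sum_pow_apply, ite_mul, zero_mul]
  rw [← sum_filter, filter_univ_mem, mul_sum]

theorem MulChar.orderOf_mul_card_nonzeroPowers {F : Type*} [Field F] [Fintype F]
    (χ : MulChar F ℂ) :
    orderOf χ * (nonzeroPowers (orderOf χ) F).card = Fintype.card F - 1 := by
  classical
  -- For trivial `ψ` only the term `i = 0` survives, and it equals `q - 1`.
  have h := χ.orderOf_mul_sum_nonzeroPowers 1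
  obtain ⟨d, hd⟩ : ∃ d, orderOf χ = d + 1 := Nat.exists_eq_succ_of_ne_zero χ.orderOf_pos.ne'
  rw [hd, Finset.sum_range_succ', Finset.sum_eq_zero fun i hi ↦ gaussSum_one_right ?_, pow_zero,
    gaussSum_one_one, ← hd, zero_add] at h
  · rw [← Fintype.card_units, ← Nat.card_eq_fintype_card]
    simp only [AddChar.one_apply, Finset.sum_const, nsmul_eq_mul, mul_one] at h
    exact_mod_cast h
  · exact pow_ne_one_of_lt_orderOf (Nat.succ_ne_zero i) (by simpa [hd] using hi)

theorem MulChar.norm_sum_nonzeroPowers_le {F : Type*} [Field F] [Fintype F]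
    (χ : MulChar F ℂ) {ψ : AddChar F ℂ} (hψ : ψ ≠ 1) :
    orderOf χ * ‖∑ y ∈ nonzeroPowers (orderOf χ) F, ψ y‖ ≤
      (orderOf χ - 1) * √(Fintype.card F) + 1 := by
  have h := χ.orderOf_mul_sum_nonzeroPowers ψ
  obtain ⟨d, hd⟩ : ∃ d, orderOf χ = d + 1 := Nat.exists_eq_succ_of_ne_zero χ.orderOf_pos.ne'
  rw [← Complex.norm_natCast, ← norm_mul, h, Complex.norm_natCast, hd, Finset.sum_range_succ',
    pow_zero, gaussSum_one_left hψ]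
  refine (norm_add_le _ _).trans (add_le_add ((norm_sum_le _ _).trans_eq ?_) (by simp))
  rw [Finset.sum_congr rfl fun i hi ↦ norm_gaussSum_eq_sqrt_card
    (pow_ne_one_of_lt_orderOf (Nat.succ_ne_zero i) (by simpa [hd] using hi)) hψ]
  simp

theorem AddChar.norm_sum_le_card {A : Type*} [AddCommGroup A] [Finite A] (ψ : AddChar A ℂ)
    (S : Finset A) : ‖∑ s ∈ S, ψ s‖ ≤ S.card := by
  simpa using norm_sum_le_of_le S fun s _ ↦ (AddChar.norm_apply ψ s).le

/-! ### Symmetry: `-1` as a `k`-th power -/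

theorem neg_one_mem_nonzeroPowers_of_odd {F : Type*} [Field F] [Fintype F] {k : ℕ} (h : Odd k) :
    (-1 : F) ∈ nonzeroPowers k F :=
  mem_nonzeroPowers.2 ⟨-1, by simp, h.neg_one_pow.symm⟩

theorem neg_one_mem_nonzeroPowers_of_dvd {F : Type*} [Field F] [Fintype F] {k : ℕ}
    (h : 2 * k ∣ Fintype.card F - 1) : (-1 : F) ∈ nonzeroPowers k F := by
  classical
  obtain ⟨c, hc⟩ := h
  rw [mem_nonzeroPowers]
  obtain ⟨g, hg⟩ := IsCyclic.exists_generator (α := Fˣ)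
  have hord : orderOf g = 2 * (k * c) := by
    rw [orderOf_eq_card_of_forall_mem_zpowers hg, Nat.card_eq_fintype_card, Fintype.card_units, hc,
      mul_assoc]
  have hpos : 0 < orderOf g := orderOf_pos g
  have h1 : ((g : F) ^ (k * c)) ^ 2 = 1 := by
    rw [← pow_mul, mul_comm, ← hord, ← Units.val_pow_eq_pow_val, pow_orderOf_eq_one, Units.val_one]
  -- As `q - 1 = 2kc`, the element `g ^ (k * c)` has order 2, so it is `-1`.
  refine ⟨(g : F) ^ c, pow_ne_zero _ g.ne_zero, ?_⟩
  rw [← pow_mul, mul_comm c]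
  refine ((eq_or_eq_neg_of_sq_eq_sq _ 1 (by rw [h1, one_pow])).resolve_left ?_).symm
  rw [← Units.val_pow_eq_pow_val, Units.val_eq_one]
  exact pow_ne_one_of_lt_orderOf (by lia) (by lia)

theorem neg_mem_nonzeroPowers {F : Type*} [Field F] [Fintype F] {k : ℕ}
    (h : (-1 : F) ∈ nonzeroPowers k F) {y : F} (hy : y ∈ nonzeroPowers k F) :
    -y ∈ nonzeroPowers k F := by
  rw [mem_nonzeroPowers] at *
  obtain ⟨a, ha, h⟩ := h
  obtain ⟨x, hx, rfl⟩ := hy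
  exact ⟨a * x, mul_ne_zero ha hx, by rw [mul_pow, ← h, neg_one_mul]⟩

/-! ### The criterion and the cases `k = 3, 4` -/

/-- Numerical criterion for a generalized Paley graph to be Ramanujan: the bound
`|η| ≤ ((k - 1) √q + 1) / k` on the Gaussian periods has to imply the Ramanujan bound. -/
theorem generalizedPaley_isRamanujan {k p m : ℕ} (hp : p.Prime) (hk : 0 < k) (hkp : k < p)
    {F : Type*} [Field F] [Fintype F] (hF : Fintype.card F = p ^ m)
    (hdvd : k ∣ Fintype.card F - 1) (hneg : (-1 : F) ∈ nonzeroPowers k F)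
    (hbound : ∀ (n : ℕ) (t : ℝ), k * n + 1 = Fintype.card F → 0 ≤ t → t ≤ n →
      k * t ≤ (k - 1) * √(Fintype.card F) + 1 → t ≤ 2 * √((n : ℝ) - 1)) :
    (generalizedPaley k F).IsRamanujan := by
  classical
  obtain ⟨χ, rfl⟩ := MulChar.exists_mulChar_orderOf F hdvd (Complex.isPrimitiveRoot_exp k hk.ne')
  set S := nonzeroPowers (orderOf χ) F
  have hcard : orderOf χ * S.card + 1 = Fintype.card F := by
    rw [χ.orderOf_mul_card_nonzeroPowers]
    exact Nat.sub_add_cancel Fintype.card_pos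
  let G : SimpleGraph F :=
    { Adj := (generalizedPaley (orderOf χ) F).Adj
      symm := ⟨fun u v h ↦ by
        have := neg_mem_nonzeroPowers hneg (mem_nonzeroPowers.2 h)
        rw [neg_sub] at this
        exact mem_nonzeroPowers.1 this⟩
      loopless := ⟨fun u h ↦ by
        have := mem_nonzeroPowers.2 h
        rw [sub_self] at this
        exact zero_notMem_nonzeroPowers this⟩ }
  have hG : ∀ u v, G.Adj u v ↔ v - u ∈ S := fun u v ↦ mem_nonzeroPowers.symm
  refine ⟨G, fun _ _ ↦ Iff.rfl, G.connected_of_closure_eq_top S hG ?_, S.card,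
    G.isRegularOfDegree_of_adj_iff_sub_mem S hG, fun μ hμ ↦ ?_⟩
  · refine AddSubgroup.closure_eq_top_of_card_lt hp hF S zero_notMem_nonzeroPowers ?_
    rw [← hF, ← hcard]
    nlinarith [Nat.zero_le S.card]
  · obtain ⟨ψ, hψ⟩ := G.exists_addChar_of_hasEigenvalue S hG hμ
    rcases eq_or_ne ψ 1 with rfl | hψ1
    · left
      have : μ = S.card := by
        simp only [AddChar.one_apply, Finset.sum_const, nsmul_eq_mul, mul_one] at hψ
        exact_mod_cast hψ
      rw [this, Nat.abs_cast]
    · right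
      have hnorm : |μ| = ‖∑ s ∈ S, ψ s‖ := by rw [← hψ, Complex.norm_real, Real.norm_eq_abs]
      refine hbound S.card |μ| hcard (abs_nonneg μ) ?_ ?_
      · rw [hnorm]; exact ψ.norm_sum_le_card S
      · rw [hnorm]; exact χ.norm_sum_nonzeroPowers_le hψ1

theorem le_two_mul_sqrt_of_sq_le {t x : ℝ} (h : t ^ 2 ≤ 4 * x) : t ≤ 2 * √x := by
  have : t / 2 ≤ √x := Real.le_sqrt_of_sq_le (by linarith)
  linarith

theorem theorem6p3 (k p m : ℕ) (hk : k = 3 ∨ k = 4) (hp : p.Prime)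
    (hpk : p ≡ 1 [MOD k]) (hm : k = 4 → Even m)
    (F : Type*) [Field F] [Fintype F] (hF : Fintype.card F = p ^ m) :
    (generalizedPaley k F).IsRamanujan := by
  have hk0 : 0 < k := by lia
  have hp2 := hp.two_le
  have hkp : k < p := by
    have := (Nat.modEq_iff_dvd' hp.one_le).1 hpk.symm
    have := Nat.le_of_dvd (by lia) this
    lia
  have hdvd : k ∣ Fintype.card F - 1 := by
    rw [hF]
    exact (Nat.modEq_iff_dvd' (Nat.one_le_pow _ _ hp.pos)).1 (by simpa using (hpk.pow m).symm)
  have hs0 : 0 ≤ √(Fintype.card F : ℝ) := Real.sqrt_nonneg _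
  have hs : √(Fintype.card F : ℝ) ^ 2 = Fintype.card F := Real.sq_sqrt (Nat.cast_nonneg _)
  set s := √(Fintype.card F : ℝ)
  rcases hk with rfl | rfl
  · refine generalizedPaley_isRamanujan hp hk0 hkp hF hdvd
      (neg_one_mem_nonzeroPowers_of_odd (by decide)) fun n t hn ht htn hts ↦ ?_
    have hm0 : m ≠ 0 := by
      rintro rfl
      exact (Fintype.one_lt_card (α := F)).ne' (by simpa using hF)
    have hn2 : 2 ≤ n := by
      have := Nat.le_self_pow hm0 p
      have : p ≠ 4 := fun h ↦ by norm_num [h] at hp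
      lia
    apply le_two_mul_sqrt_of_sq_le
    -- For `n = 2`, i.e. `q = 7`, the Gauss sum bound is too weak; `t ≤ n` is used.
    rcases hn2.eq_or_lt with rfl | hn3
    · push_cast at htn ⊢
      nlinarith
    · have hq : (Fintype.card F : ℝ) = 3 * n + 1 := by exact_mod_cast hn.symm
      have hn3' : (3 : ℝ) ≤ n := by exact_mod_cast hn3
      change 3 * t ≤ (3 - 1) * s + 1 at hts
      rw [hq] at hs
      have : 3 ≤ s := by nlinarith
      nlinarith
  · obtain ⟨r, rfl⟩ := hm rfl
    have hr0 : r ≠ 0 := by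
      rintro rfl
      exact (Fintype.one_lt_card (α := F)).ne' (by simpa using hF)
    -- Evenness of `m` enters here: it makes `q` a power of `p ^ 2 ≡ 1` mod 8.
    have h8 : 2 * 4 ∣ Fintype.card F - 1 := by
      rw [hF, ← two_mul, pow_mul]
      refine (Nat.modEq_iff_dvd' (Nat.one_le_pow _ _ (by positivity))).1 ?_
      have : p ^ 2 ≡ 1 [MOD 8] := by
        obtain ⟨c, hc⟩ := (Nat.modEq_iff_dvd' hp.one_le).1 hpk.symm
        obtain rfl : p = 4 * c + 1 := by lia
        rw [show (4 * c + 1) ^ 2 = 1 + 8 * (2 * c ^ 2 + c) by ring]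
        simp [Nat.ModEq]
      simpa using (this.pow r).symm
    refine generalizedPaley_isRamanujan hp hk0 hkp hF hdvd
      (neg_one_mem_nonzeroPowers_of_dvd h8) fun n t hn ht htn hts ↦ ?_
    have hn6 : 6 ≤ n := by
      have h1 : 5 ≤ p ^ r := hkp.trans_le (Nat.le_self_pow hr0 p)
      rw [hF, pow_add] at hn
      nlinarith
    have hq : (Fintype.card F : ℝ) = 4 * n + 1 := by exact_mod_cast hn.symm
    have hn6' : (6 : ℝ) ≤ n := by exact_mod_cast hn6
    change 4 * t ≤ (4 - 1) * s + 1 at hts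
    rw [hq] at hs
    -- The goal reduces to `7s² - 6s - 81 ≥ 0`.
    have : 5 ≤ s := by nlinarith
    apply le_two_mul_sqrt_of_sq_le
    nlinarith
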